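/- Let $\mathbf{sSet}$ be the category of simplicial sets and $\mathbf{sCat}$ the category of small simplicially enriched categories and simplicial functors. Each carries a covariant involution $(-)^{\mathrm{op}}$: for a simplicial set it reverses the order of the vertices of simplices, and for a simplicial category $X$ the opposite $X^{\mathrm{op}}$ has the same objects and $X^{\mathrm{op}}(a,b)=X(b,a)$; the double opposite is identified with the identity. In either category an anti-involution on an object $Y$ is a map $\tau\colon Y^{\mathrm{op}}\to Y$ with $\tau^{\mathrm{op}}\circ\tau=\mathrm{id}_{Y^{\mathrm{op}}}$. Let $\mathbf{isSet}$ and $\mathbf{isCat}$ be the categories of pairs $(Y,\tau)$ consisting of a simplicial set (respectively a small simplicial category) and an anti-involution on it; a morphism $(Y,\tau)\to(Y',\tau')$ is a map $f\colon Y\to Y'$ with $\tau' f^{\mathrm{op}}=f\tau$. Let $\mathfrak{C}\colon\mathbf{sSet}\rightleftarrows\mathbf{sCat}\colon N_{hc}$ be the adjunction between the realization $\mathfrak{C}$ (the colimit-preserving extension of the simplicial thickening $[n]\mapsto\mathfrak{C}[\Delta^n]$) and the homotopy coherent nerve $N_{hc}(X)_n=\mathbf{sCat}(\mathfrak{C}[\Delta^n],X)$,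 with unit $\eta$ and counit $\varepsilon$. (1) There exist natural isomorphisms $z\colon N_{hc}(-)^{\mathrm{op}}\to N_{hc}((-)^{\mathrm{op}})$ and $w\colon\mathfrak{C}(-)^{\mathrm{op}}\to\mathfrak{C}((-)^{\mathrm{op}})$ which are coherent, meaning that $z^{-1}=z^{\mathrm{op}}$ (that is, $(z_X)^{\mathrm{op}}$ and $z_{X^{\mathrm{op}}}$ are mutually inverse for every $X$), $w^{-1}=w^{\mathrm{op}}$ (likewise), and, for every simplicial set $A$, \[ w_A^{-1}=\varepsilon_{(\mathfrak{C}A)^{\mathrm{op}}}\circ\mathfrak{C}(z_{\mathfrak{C}A})\circ\mathfrak{C}((\eta_A)^{\mathrm{op}}). \] (2) Let $z,w$ be any coherent pair as in (1). If $\tau\colon X^{\mathrm{op}}\to X$ is an anti-involution in $\mathbf{sCat}$, then $N_{hc}(\tau)\circ z_X$ is an anti-involution on $N_{hc}(X)$; if $\sigma\colon A^{\mathrm{op}}\to A$ is an anti-involution in $\mathbf{sSet}$, then $\mathfrak{C}(\sigma)\circ w_A$ is an anti-involution on $\mathfrak{C}(A)$. Hence \[ \widetilde{\mathfrak{C}}(A,\sigma)=(\mathfrak{C}(A),\,\mathfrak{C}(\sigma)\circ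 w_A),\qquad \widetilde{N}_{hc}(X,\tau)=(N_{hc}(X),\,N_{hc}(\tau)\circ z_X), \] acting on morphisms as $\mathfrak{C}$ and $N_{hc}$, are functors $\widetilde{\mathfrak{C}}\colon\mathbf{isSet}\to\mathbf{isCat}$ and $\widetilde{N}_{hc}\colon\mathbf{isCat}\to\mathbf{isSet}$. The functor $\widetilde{\mathfrak{C}}$ is left adjoint to $\widetilde{N}_{hc}$, by an adjunction that lifts $\mathfrak{C}\dashv N_{hc}$: the map underlying the adjunct of $f$ is the adjunct of the map underlying $f$. -/

import Mathlib

open CategoryTheory MonoidalCategory Opposite Limits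

universe u

/-- A small simplicially enriched category (objects form a small type, homs are simplicial sets). -/
structure SCat : Type (u + 1) where
  /-- the type of objects -/
  carrier : Type u
  [enriched : EnrichedCategory SSet.{u} carrier]

namespace SCat

instance : CoeSort SCat.{u} (Type u) := ⟨carrier⟩

attribute [instance] SCat.enriched

theorem functor_ext {C D : Type u} [EnrichedCategory SSet.{u} C] [EnrichedCategory SSet.{u} D]
    {F G : EnrichedFunctor SSet.{u} C D} (hobj : ∀ x, F.obj x = G.obj x)
    (hmap : ∀ (x y : C) (m : SimplexCategoryᵒᵖ) (s : (x ⟶[SSet.{u}] y).obj m),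
      (F.map x y).app m s ≍ (G.map x y).app m s) : F = G := by
  obtain ⟨Fo, Fm, _, _⟩ := F
  obtain ⟨Go, Gm, _, _⟩ := G
  obtain rfl : Fo = Go := funext hobj
  obtain rfl : Fm = Gm := by
    funext x y
    ext m s
    exact eq_of_heq (hmap x y m s)
  rfl

/-- The category of small simplicial categories; morphisms are simplicial functors. -/
instance : Category.{u} SCat.{u} where
  Hom X Y := EnrichedFunctor SSet.{u} X Y
  id X := EnrichedFunctor.id SSet.{u} X
  comp F G := EnrichedFunctor.comp SSet.{u} F G
  id_comp _ := functor_ext (fun _ => rfl) (fun _ _ _ _ => HEq.rfl)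
  comp_id _ := functor_ext (fun _ => rfl) (fun _ _ _ _ => HEq.rfl)
  assoc _ _ _ := functor_ext (fun _ => rfl) (fun _ _ _ _ => HEq.rfl)

/-- The opposite simplicial functor, acting on objects and homs as `F`. -/
def opMap {X Y : SCat.{u}} (F : EnrichedFunctor SSet.{u} X Y) :
    EnrichedFunctor SSet.{u} Xᵒᵖ Yᵒᵖ where
  obj x := op (F.obj x.unop)
  map x y := F.map y.unop x.unop
  map_id x := F.map_id x.unop
  map_comp x y z := by
    have h := F.map_comp z.unop y.unop x.unop
    rw [eComp_op_eq, eComp_op_eq, Category.assoc, h]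
    exact (BraidedCategory.braiding_naturality_assoc _ _ _).symm

/-- The opposite `Xᵒᵖ` of a simplicial category: same objects, `Xᵒᵖ(a, b) = X(b, a)`. -/
def opFunctor : SCat.{u} ⥤ SCat.{u} where
  obj X := ⟨(X : Type u)ᵒᵖ⟩
  map F := opMap F
  map_id _ := rfl
  map_comp _ _ := rfl

/-- The evident identification of the double opposite of `X` with `X`. -/
def opOpIsoApp (X : SCat.{u}) : opFunctor.obj (opFunctor.obj X) ≅ X where
  hom :=
    { obj := fun x => x.unop.unop
      map := fun _ _ => 𝟙 _
      map_id := fun _ => rfl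
      map_comp := fun x y z => by
        ext m s
        rfl }
  inv :=
    { obj := fun x => op (op x)
      map := fun _ _ => 𝟙 _
      map_id := fun _ => rfl
      map_comp := fun x y z => by
        ext m s
        rfl }
  hom_inv_id := rfl
  inv_hom_id := rfl

/-- The opposite functor of `SCat` is an involution. -/
def opOpIso : opFunctor.{u} ⋙ opFunctor.{u} ≅ 𝟭 SCat.{u} :=
  NatIso.ofComponents opOpIsoApp (fun _ => rfl)

/-- The simplicial thickening of the linear orders `{0 < ... < n}`, as a cosimplicial object in
simplicial categories. -/
def thickening : SimplexCategory ⥤ SCat.{u} where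
  obj n := ⟨SimplicialThickening (ULift.{u} (Fin (n.len + 1)))⟩
  map f := SimplicialThickening.functor f.toOrderHom.uliftMap
  map_id _ := SimplicialThickening.functor_id _
  map_comp f g := SimplicialThickening.functor_comp f.toOrderHom.uliftMap g.toOrderHom.uliftMap

/-- The homotopy coherent nerve: the `n`-simplices of `Nhc.obj X` are the simplicial functors
from the simplicial thickening of `{0 < ... < n}` to `X`. -/
def Nhc : SCat.{u} ⥤ SSet.{u} := Presheaf.restrictedULiftYoneda.{0} thickening.{u}

/-! ### Composition of simplices of the hom objects -/

section Elementwise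

variable {C : Type u} [EnrichedCategory SSet.{u} C] {m m' : SimplexCategoryᵒᵖ}

/-- A pair of simplices, as a simplex of the product. -/
def pair {K L : SSet.{u}} (s : K.obj m) (t : L.obj m) : (K ⊗ L).obj m := (s, t)

/-- The `m`-simplices of the hom object from `x` to `y`. -/
abbrev Simp (m : SimplexCategoryᵒᵖ) (x y : C) : Type u := (x ⟶[SSet.{u}] y).obj m

/-- The identity of `x`, as a degenerate `m`-simplex. -/
def sId (m : SimplexCategoryᵒᵖ) (x : C) : Simp m x x := (eId SSet.{u} x).app m PUnit.unit

/-- Composition of `m`-simplices. -/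
def sComp {x y z : C} (s : Simp m x y) (t : Simp m y z) : Simp m x z :=
  (eComp SSet.{u} x y z).app m (pair s t)

theorem sId_sComp {x y : C} (s : Simp m x y) : sComp (sId m x) s = s :=
  ConcreteCategory.congr_hom (NatTrans.congr_app (e_id_comp SSet.{u} x y) m) s

theorem sComp_sId {x y : C} (s : Simp m x y) : sComp s (sId m y) = s :=
  ConcreteCategory.congr_hom (NatTrans.congr_app (e_comp_id SSet.{u} x y) m) s

theorem sComp_assoc {w x y z : C} (r : Simp m w x) (s : Simp m x y) (t : Simp m y z) :
    sComp (sComp r s) t = sComp r (sComp s t) := by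
  let p := pair r (pair s t)
  exact ConcreteCategory.congr_hom (NatTrans.congr_app (e_assoc SSet.{u} w x y z) m) p

theorem map_sId (f : m ⟶ m') (x : C) : (x ⟶[SSet.{u}] x).map f (sId m x) = sId m' x :=
  (NatTrans.naturality_apply (eId SSet.{u} x) f PUnit.unit).symm

theorem map_sComp (f : m ⟶ m') {x y z : C} (s : Simp m x y) (t : Simp m y z) :
    (x ⟶[SSet.{u}] z).map f (sComp s t) =
      sComp ((x ⟶[SSet.{u}] y).map f s) ((y ⟶[SSet.{u}] z).map f t) := by
  let p := pair s t
  exact (NatTrans.naturality_apply (eComp SSet.{u} x y z) f p).symm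

theorem functor_sId {D : Type u} [EnrichedCategory SSet.{u} D] (F : EnrichedFunctor SSet.{u} C D)
    (x : C) : (F.map x x).app m (sId m x) = sId m (F.obj x) :=
  ConcreteCategory.congr_hom (NatTrans.congr_app (F.map_id x) m) PUnit.unit

theorem functor_sComp {D : Type u} [EnrichedCategory SSet.{u} D]
    (F : EnrichedFunctor SSet.{u} C D) {x y z : C} (s : Simp m x y) (t : Simp m y z) :
    (F.map x z).app m (sComp s t) = sComp ((F.map x y).app m s) ((F.map y z).app m t) := by
  let p := pair s t
  exact ConcreteCategory.congr_hom (NatTrans.congr_app (F.map_comp x y z) m) p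

theorem sComp_heq {x y z x' y' z' : C} (hx : x = x') (hy : y = y') (hz : z = z')
    {s : Simp m x y} {t : Simp m y z} {s' : Simp m x' y'} {t' : Simp m y' z'}
    (hs : s ≍ s') (ht : t ≍ t') : sComp s t ≍ sComp s' t' := by
  subst hx hy hz
  rw [eq_of_heq hs, eq_of_heq ht]

theorem sId_heq {x x' : C} (hx : x = x') : sId m x ≍ sId m x' := by rw [hx]

theorem map_heq (f : m ⟶ m') {x y x' y' : C} (hx : x = x') (hy : y = y')
    {s : Simp m x y} {s' : Simp m x' y'} (hs : s ≍ s') :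
    (x ⟶[SSet.{u}] y).map f s ≍ (x' ⟶[SSet.{u}] y').map f s' := by
  subst hx hy
  rw [eq_of_heq hs]

theorem functor_congr {X Y : SCat.{u}} {F G : X ⟶ Y} (h : F = G) (x y : X) (s : Simp m x y) :
    (EnrichedFunctor.map F x y).app m s ≍ (EnrichedFunctor.map G x y).app m s := by rw [h]

end Elementwise

/-! ### Colimits of simplicial categories, by generators and relations -/

namespace Colim

variable {J : Type u} [Category.{0} J] (D : J ⥤ SCat.{u})

/-- Two objects of the diagram are identified along the transition functors. -/
inductive ObRel : (Σ j, D.obj j) → (Σ j, D.obj j) → Prop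
  | map {j j' : J} (f : j ⟶ j') (a : D.obj j) : ObRel ⟨j, a⟩ ⟨j', EnrichedFunctor.obj (D.map f) a⟩

/-- Objects of the colimit. -/
def Ob : Type u := Quot (ObRel D)

variable {D}

/-- The class of an object of the diagram. -/
def ob (j : J) (a : D.obj j) : Ob D := Quot.mk _ ⟨j, a⟩

theorem ob_map {j j' : J} (f : j ⟶ j') (a : D.obj j) :
    ob j' (EnrichedFunctor.obj (D.map f) a) = ob j a := (Quot.sound (ObRel.map f a)).symm

variable (D)

/-- Formal composites of `m`-simplices of the categories of the diagram. -/
inductive Word (m : SimplexCategoryᵒᵖ) : Ob D → Ob D → Type u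
  | of {x y : Ob D} (j : J) (a b : D.obj j) (s : Simp m a b) (hx : ob j a = x) (hy : ob j b = y) :
      Word m x y
  | id (x : Ob D) : Word m x x
  | comp {x y z : Ob D} (p : Word m x y) (q : Word m y z) : Word m x z

variable {D}

/-- The congruence on words generated by the category axioms, the relations of the categories of
the diagram, and the transition functors. -/
inductive WordRel (m : SimplexCategoryᵒᵖ) : {x y : Ob D} → Word D m x y → Word D m x y → Prop
  | refl {x y : Ob D} (p : Word D m x y) : WordRel m p p
  | symm {x y : Ob D} {p q : Word D m x y} : WordRel m p q → WordRel m q p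
  | trans {x y : Ob D} {p q r : Word D m x y} : WordRel m p q → WordRel m q r → WordRel m p r
  | congr {x y z : Ob D} {p p' : Word D m x y} {q q' : Word D m y z} :
      WordRel m p p' → WordRel m q q' → WordRel m (p.comp q) (p'.comp q')
  | id_comp {x y : Ob D} (p : Word D m x y) : WordRel m ((Word.id x).comp p) p
  | comp_id {x y : Ob D} (p : Word D m x y) : WordRel m (p.comp (Word.id y)) p
  | assoc {w x y z : Ob D} (p : Word D m w x) (q : Word D m x y) (r : Word D m y z) :
      WordRel m ((p.comp q).comp r) (p.comp (q.comp r))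
  | of_id {x : Ob D} (j : J) (a : D.obj j) (hx : ob j a = x) :
      WordRel m (Word.of j a a (sId m a) hx hx) (Word.id x)
  | of_comp {x y z : Ob D} (j : J) (a b c : D.obj j) (s : Simp m a b) (t : Simp m b c)
      (hx : ob j a = x) (hy : ob j b = y) (hz : ob j c = z) :
      WordRel m ((Word.of j a b s hx hy).comp (Word.of j b c t hy hz))
        (Word.of j a c (sComp s t) hx hz)
  | of_map {x y : Ob D} {j j' : J} (f : j ⟶ j') (a b : D.obj j) (s : Simp m a b)
      (hx : ob j a = x) (hy : ob j b = y) :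
      WordRel m (Word.of j a b s hx hy)
        (Word.of j' _ _ ((EnrichedFunctor.map (D.map f) a b).app m s)
          ((ob_map f a).trans hx) ((ob_map f b).trans hy))

/-- Simplicial operators act on words letter by letter. -/
def Word.act {m m' : SimplexCategoryᵒᵖ} (f : m ⟶ m') {x y : Ob D} : Word D m x y → Word D m' x y
  | .of j a b s hx hy => .of j a b ((a ⟶[SSet.{u}] b).map f s) hx hy
  | .id x => .id x
  | .comp p q => .comp (p.act f) (q.act f)

theorem WordRel.act {m m' : SimplexCategoryᵒᵖ} (f : m ⟶ m') {x y : Ob D} {p q : Word D m x y}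
    (h : WordRel m p q) : WordRel m' (p.act f) (q.act f) := by
  induction h with
  | refl p => exact .refl _
  | symm _ ih => exact ih.symm
  | trans _ _ ih ih' => exact ih.trans ih'
  | congr _ _ ih ih' => exact .congr ih ih'
  | id_comp p => exact .id_comp _
  | comp_id p => exact .comp_id _
  | assoc p q r => exact .assoc _ _ _
  | of_id j a hx =>
    simp only [Word.act, map_sId]
    exact .of_id _ _ _
  | of_comp j a b c s t hx hy hz =>
    simp only [Word.act, map_sComp]
    exact .of_comp _ _ _ _ _ _ _ _ _
  | of_map g a b s hx hy =>
    simp only [Word.act]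
    rw [← NatTrans.naturality_apply]
    exact .of_map g _ _ _ _ _

theorem Word.act_id {m : SimplexCategoryᵒᵖ} {x y : Ob D} (p : Word D m x y) :
    p.act (𝟙 m) = p := by
  induction p with
  | of j a b s hx hy => simp [Word.act]
  | id x => rfl
  | comp p q ih ih' => simp [Word.act, ih, ih']

theorem Word.act_comp {m m' m'' : SimplexCategoryᵒᵖ} (f : m ⟶ m') (g : m' ⟶ m'') {x y : Ob D}
    (p : Word D m x y) : p.act (f ≫ g) = (p.act f).act g := by
  induction p with
  | of j a b s hx hy => simp [Word.act]
  | id x => rfl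
  | comp p q ih ih' => simp [Word.act, ih, ih']

/-- The hom simplicial sets of the colimit. -/
def homObj (x y : Ob D) : SSet.{u} where
  obj m := Quot (WordRel m (x := x) (y := y))
  map f := ↾(Quot.map (Word.act f) (fun _ _ h => h.act f))
  map_id m := by
    ext p
    induction p using Quot.ind with | mk p => exact congrArg (Quot.mk _) p.act_id
  map_comp f g := by
    ext p
    induction p using Quot.ind with | mk p => exact congrArg (Quot.mk _) (p.act_comp f g)

/-- Composition of classes of words. -/
def compQuot {m : SimplexCategoryᵒᵖ} {x y z : Ob D} :
    Quot (WordRel m (x := x) (y := y)) → Quot (WordRel m (x := y) (y := z)) →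
      Quot (WordRel m (x := x) (y := z)) :=
  Quot.map₂ Word.comp (fun _ _ _ h => .congr (.refl _) h) (fun _ _ _ h => .congr h (.refl _))

instance : EnrichedCategory SSet.{u} (Ob D) where
  Hom x y := homObj x y
  id x := { app := fun m => ↾(fun _ => Quot.mk _ (Word.id x)), naturality := fun _ _ _ => rfl }
  comp x y z :=
    { app := fun m => ↾(fun p => compQuot p.1 p.2)
      naturality := fun m m' f => by
        ext ⟨p, q⟩
        induction p using Quot.ind with | mk p =>
        induction q using Quot.ind with | mk q => rfl }
  id_comp x y := by
    ext m p
    induction p using Quot.ind with | mk p => exact Quot.sound (.id_comp p)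
  comp_id x y := by
    ext m p
    induction p using Quot.ind with | mk p => exact Quot.sound (.comp_id p)
  assoc w x y z := by
    ext m ⟨p, q, r⟩
    induction p using Quot.ind with | mk p =>
    induction q using Quot.ind with | mk q =>
    induction r using Quot.ind with | mk r => exact Quot.sound (.assoc p q r)

/-- The canonical functor from a category of the diagram to the colimit. -/
def ι (j : J) : EnrichedFunctor SSet.{u} (D.obj j) (Ob D) where
  obj a := ob j a
  map a b :=
    { app := fun m => ↾(fun s => Quot.mk _ (Word.of j a b s rfl rfl))
      naturality := fun m m' f => by ext s; rfl }
  map_id a := by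
    ext m s
    exact Quot.sound (.of_id j a rfl)
  map_comp a b c := by
    ext m ⟨s, t⟩
    exact (Quot.sound (.of_comp j a b c s t rfl rfl rfl)).symm

theorem mk_of_heq {m : SimplexCategoryᵒᵖ} {x y x' y' : Ob D} (hx : x = x') (hy : y = y') (j : J)
    (a b : D.obj j) (s : Simp m a b) (h₁ : ob j a = x) (h₂ : ob j b = y) (h₁' : ob j a = x')
    (h₂' : ob j b = y') :
    (Quot.mk (WordRel m) (Word.of j a b s h₁ h₂) : (homObj x y).obj m) ≍
      (Quot.mk (WordRel m) (Word.of j a b s h₁' h₂') : (homObj x' y').obj m) := by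
  subst hx hy
  rfl

variable (D)

/-- The colimit cocone. -/
def cocone : Cocone D where
  pt := ⟨Ob D⟩
  ι :=
    { app := fun j => ι j
      naturality := fun j j' f => by
        refine functor_ext (fun a => ob_map f a) (fun a b m s => ?_)
        exact (mk_of_heq (ob_map f a) (ob_map f b) j' _ _
          ((EnrichedFunctor.map (D.map f) a b).app m s) rfl rfl (ob_map f a) (ob_map f b)).trans
          (heq_of_eq (Quot.sound (.of_map f a b s rfl rfl)).symm) }

variable {D} (c : Cocone D)

/-- The functor out of the colimit induced by a cocone, on objects. -/
def descObj : Ob D → c.pt :=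
  Quot.lift (fun p => EnrichedFunctor.obj (c.ι.app p.1) p.2) (by
    rintro _ _ ⟨f, a⟩
    exact (congrArg (fun F : EnrichedFunctor SSet.{u} _ _ => F.obj a) (c.w f)).symm)

/-- The functor out of the colimit induced by a cocone, on words. -/
def descWord {m : SimplexCategoryᵒᵖ} {x y : Ob D} :
    Word D m x y → Simp m (descObj c x) (descObj c y)
  | .of j a b s hx hy =>
    cast (by subst hx hy; rfl) ((EnrichedFunctor.map (c.ι.app j) a b).app m s)
  | .id x => sId m _
  | .comp p q => sComp (descWord p) (descWord q)

theorem descWord_of {m : SimplexCategoryᵒᵖ} {x y : Ob D} (j : J) (a b : D.obj j) (s : Simp m a b)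
    (hx : ob j a = x) (hy : ob j b = y) :
    descWord c (.of j a b s hx hy) ≍ (EnrichedFunctor.map (c.ι.app j) a b).app m s :=
  cast_heq _ _

theorem descWord_rel {m : SimplexCategoryᵒᵖ} {x y : Ob D} {p q : Word D m x y}
    (h : WordRel m p q) : descWord c p = descWord c q := by
  induction h with
  | refl p => rfl
  | symm _ ih => exact ih.symm
  | trans _ _ ih ih' => exact ih.trans ih'
  | congr _ _ ih ih' => simp only [descWord, ih, ih']
  | id_comp p => exact sId_sComp _
  | comp_id p => exact sComp_sId _
  | assoc p q r => exact sComp_assoc _ _ _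
  | of_id j a hx =>
    subst hx
    exact functor_sId (c.ι.app j) a
  | of_comp j a b c' s t hx hy hz =>
    subst hx hy hz
    exact (functor_sComp (c.ι.app j) s t).symm
  | of_map f a b s hx hy =>
    apply eq_of_heq
    refine (descWord_of c _ _ _ _ _ _).trans (HEq.trans ?_ (descWord_of c _ _ _ _ _ _).symm)
    exact functor_congr (c.w f).symm a b s

theorem descWord_act {m m' : SimplexCategoryᵒᵖ} (f : m ⟶ m') {x y : Ob D} (p : Word D m x y) :
    descWord c (p.act f) = (descObj c x ⟶[SSet.{u}] descObj c y).map f (descWord c p) := by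
  induction p with
  | of j a b s hx hy =>
    subst hx hy
    exact NatTrans.naturality_apply (EnrichedFunctor.map (c.ι.app j) a b) f s
  | id x => exact (map_sId f _).symm
  | comp p q ih ih' =>
    simp only [Word.act, descWord, ih, ih']
    exact (map_sComp f _ _).symm

/-- The functor out of the colimit induced by a cocone. -/
def desc : EnrichedFunctor SSet.{u} (Ob D) c.pt where
  obj := descObj c
  map x y :=
    { app := fun m => ↾(Quot.lift (descWord c) (fun _ _ h => descWord_rel c h))
      naturality := fun m m' f => by
        ext p
        induction p using Quot.ind with | mk p => exact descWord_act c f p }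
  map_id x := by
    ext m s
    rfl
  map_comp x y z := by
    ext m ⟨p, q⟩
    induction p using Quot.ind with | mk p =>
    induction q using Quot.ind with | mk q => rfl

variable (D)

/-- The cocone constructed above is a colimit cocone. -/
def isColimit : IsColimit (cocone D) where
  desc c := desc c
  fac c j := functor_ext (fun a => rfl) (fun a b m s => HEq.rfl)
  uniq c F hF := by
    have hobj : ∀ x : Ob D, EnrichedFunctor.obj F x = descObj c x := by
      intro x
      induction x using Quot.ind with | mk p =>
      exact congrArg (fun G : EnrichedFunctor SSet.{u} _ _ => G.obj p.2) (hF p.1)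
    refine functor_ext hobj (fun x y m p => ?_)
    induction p using Quot.ind with | mk p =>
    change _ ≍ descWord c p
    induction p with
    | of j a b s hx hy =>
      subst hx hy
      exact functor_congr (hF j) a b s
    | id x => exact (heq_of_eq (functor_sId F x)).trans (sId_heq (hobj x))
    | comp p q ih ih' =>
      exact (heq_of_eq (functor_sComp F (Quot.mk _ p) (Quot.mk _ q))).trans
        (sComp_heq (hobj _) (hobj _) (hobj _) ih ih')

end Colim

instance : HasColimitsOfSize.{0, u} SCat.{u} where
  has_colimits_of_shape _ _ :=
    { has_colimit := fun D => ⟨⟨⟨Colim.cocone D, Colim.isColimit D⟩⟩⟩ }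

/-- The realization `𝔆`: the left Kan extension of the simplicial thickening along the Yoneda
embedding, so that `𝔆 A` is the colimit of the thickenings over the simplices of `A`. -/
noncomputable def realization : SSet.{u} ⥤ SCat.{u} :=
  (uliftYoneda.{u} : SimplexCategory ⥤ SSet.{u}).leftKanExtension thickening.{u}

/-- The adjunction `𝔆 ⊣ N_hc`. -/
noncomputable def adj : realization.{u} ⊣ Nhc.{u} :=
  Presheaf.uliftYonedaAdjunction.{0}
    ((uliftYoneda.{u} : SimplexCategory ⥤ SSet.{u}).leftKanExtension thickening.{u})
    (uliftYoneda.{u}.leftKanExtensionUnit thickening.{u})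

end SCat

/-! ### Anti-involutive objects -/

section AntiInvolution

variable {C : Type*} [Category C] {D : Type*} [Category D]

/-- For a category with a covariant involution `o` (with `e : o (o X) ≅ X`), a map `τ : o X ⟶ X`
is an anti-involution if `τᵒᵖ ∘ τ` is the identity of `o X`, the domain `o (o X)` of `τᵒᵖ` being
identified with `X` by `e`. -/
def IsAntiInvolution (o : C ⥤ C) (e : o ⋙ o ≅ 𝟭 C) {X : C} (τ : o.obj X ⟶ X) : Prop :=
  τ ≫ e.inv.app X ≫ o.map τ = 𝟙 (o.obj X)

/-- Objects equipped with an anti-involution. -/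
structure AntiInvolutive (o : C ⥤ C) (e : o ⋙ o ≅ 𝟭 C) where
  /-- the underlying object -/
  obj : C
  /-- the anti-involution -/
  τ : o.obj obj ⟶ obj
  isAntiInvolution : IsAntiInvolution o e τ

namespace AntiInvolutive

variable {o : C ⥤ C} {e : o ⋙ o ≅ 𝟭 C}

/-- Morphisms are the maps `f` with `τ ∘ fᵒᵖ = f ∘ τ`. -/
@[ext]
structure Hom (X Y : AntiInvolutive o e) where
  /-- the underlying map -/
  hom : X.obj ⟶ Y.obj
  comm : o.map hom ≫ Y.τ = X.τ ≫ hom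

instance : Category (AntiInvolutive o e) where
  Hom X Y := Hom X Y
  id X := ⟨𝟙 X.obj, by simp⟩
  comp f g := ⟨f.hom ≫ g.hom, by rw [o.map_comp, Category.assoc, g.comm, ← Category.assoc, f.comm,
    Category.assoc]⟩
  id_comp f := Hom.ext (Category.id_comp f.hom)
  comp_id f := Hom.ext (Category.comp_id f.hom)
  assoc f g h := Hom.ext (Category.assoc f.hom g.hom h.hom)

end AntiInvolutive

variable {o : C ⥤ C} {e : o ⋙ o ≅ 𝟭 C} {o' : D ⥤ D} {e' : o' ⋙ o' ≅ 𝟭 D}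

/-- For a natural isomorphism `k : (H -)ᵒᵖ ≅ H (-ᵒᵖ)`, the condition `k⁻¹ = kᵒᵖ`: for every `X`,
the maps `(k_X)ᵒᵖ : H X = (H X)ᵒᵖᵒᵖ ⟶ (H Xᵒᵖ)ᵒᵖ` and
`k_{Xᵒᵖ} : (H Xᵒᵖ)ᵒᵖ ⟶ H Xᵒᵖᵒᵖ = H X` are inverse to each other. -/
def InverseEqOp (e : o ⋙ o ≅ 𝟭 C) (e' : o' ⋙ o' ≅ 𝟭 D) {H : C ⥤ D} (k : H ⋙ o' ≅ o ⋙ H) : Prop :=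
  ∀ X : C, (e'.inv.app (H.obj X) ≫ o'.map (k.hom.app X)) ≫
    (k.hom.app (o.obj X) ≫ H.map (e.hom.app X)) = 𝟙 (H.obj X)

/-- The map `H(τ) ∘ k_X : (H X)ᵒᵖ ⟶ H X` obtained from `τ : Xᵒᵖ ⟶ X`. -/
def transport {H : C ⥤ D} (k : H ⋙ o' ≅ o ⋙ H) {X : C} (τ : o.obj X ⟶ X) :
    o'.obj (H.obj X) ⟶ H.obj X :=
  k.hom.app X ≫ H.map τ

theorem IsAntiInvolution.transport {H : C ⥤ D} {k : H ⋙ o' ≅ o ⋙ H} (hk : InverseEqOp e e' k)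
    {X : C} {τ : o.obj X ⟶ X} (hτ : IsAntiInvolution o e τ) :
    IsAntiInvolution o' e' (_root_.transport k τ) := by
  unfold IsAntiInvolution _root_.transport at *
  have h := hk X
  have hn := k.hom.naturality τ
  dsimp at h hn hτ ⊢
  rw [← cancel_mono (k.hom.app X)]
  simp only [Functor.map_comp, Category.assoc, Category.id_comp]
  dsimp
  rw [hn]
  have h2 : e'.inv.app (H.obj X) ≫ o'.map (k.hom.app X) ≫ k.hom.app (o.obj X) =
      H.map (e.inv.app X) := by
    rw [← cancel_mono (H.map (e.hom.app X)), ← H.map_comp]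
    simpa using h
  have h3 := congrArg (fun t => k.hom.app X ≫ H.map t) hτ
  simp only [Functor.map_comp] at h3
  rw [← reassoc_of% h2] at h3
  simpa using h3

/-- The functor `(X, τ) ↦ (H X, H(τ) ∘ k_X)`, `f ↦ H f`. -/
def liftFunctor (H : C ⥤ D) (k : H ⋙ o' ≅ o ⋙ H) (hk : InverseEqOp e e' k) :
    AntiInvolutive o e ⥤ AntiInvolutive o' e' where
  obj X := ⟨H.obj X.obj, transport k X.τ, X.isAntiInvolution.transport hk⟩
  map {X Y} f := ⟨H.map f.hom, by
    have h := k.hom.naturality f.hom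
    have h' := congrArg H.map f.comm
    dsimp at h
    simp only [Functor.map_comp] at h'
    simp only [transport, Category.assoc, ← h']
    rw [reassoc_of% h]⟩
  map_id X := AntiInvolutive.Hom.ext (H.map_id X.obj)
  map_comp f g := AntiInvolutive.Hom.ext (H.map_comp f.hom g.hom)

end AntiInvolution

/-- Simplicial sets with anti-involution. -/
abbrev ISSet : Type (u + 1) := AntiInvolutive SSet.opFunctor.{u} SSet.opFunctorCompOpFunctorIso.{u}

/-- Simplicial categories with anti-involution. -/
abbrev ISCat : Type (u + 1) := AntiInvolutive SCat.opFunctor.{u} SCat.opOpIso.{u}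

/-- Coherence of a pair of natural isomorphisms `z : (N_hc -)ᵒᵖ ≅ N_hc (-ᵒᵖ)` and
`w : (𝔆 -)ᵒᵖ ≅ 𝔆 (-ᵒᵖ)`. -/
structure Coherent (z : SCat.Nhc.{u} ⋙ SSet.opFunctor.{u} ≅ SCat.opFunctor.{u} ⋙ SCat.Nhc.{u})
    (w : SCat.realization.{u} ⋙ SCat.opFunctor.{u} ≅
      SSet.opFunctor.{u} ⋙ SCat.realization.{u}) : Prop where
  /-- `z⁻¹ = zᵒᵖ` -/
  z_inv : InverseEqOp SCat.opOpIso SSet.opFunctorCompOpFunctorIso z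
  /-- `w⁻¹ = wᵒᵖ` -/
  w_inv : InverseEqOp SSet.opFunctorCompOpFunctorIso SCat.opOpIso w
  /-- `w_A⁻¹ = ε_{(𝔆 A)ᵒᵖ} ∘ 𝔆(z_{𝔆 A}) ∘ 𝔆((η_A)ᵒᵖ)` -/
  w_eq : ∀ A : SSet.{u}, w.inv.app A =
    SCat.realization.map (SSet.opFunctor.map (SCat.adj.unit.app A)) ≫
      SCat.realization.map (z.hom.app (SCat.realization.obj A)) ≫
        SCat.adj.counit.app (SCat.opFunctor.obj (SCat.realization.obj A))

/-- The lifted realization `(A, σ) ↦ (𝔆 A, 𝔆(σ) ∘ w_A)`. -/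
noncomputable def realizationTilde
    {z : SCat.Nhc.{u} ⋙ SSet.opFunctor.{u} ≅ SCat.opFunctor.{u} ⋙ SCat.Nhc.{u}}
    {w : SCat.realization.{u} ⋙ SCat.opFunctor.{u} ≅ SSet.opFunctor.{u} ⋙ SCat.realization.{u}}
    (h : Coherent z w) : ISSet.{u} ⥤ ISCat.{u} :=
  liftFunctor SCat.realization w h.w_inv

/-- The lifted homotopy coherent nerve `(X, τ) ↦ (N_hc X, N_hc(τ) ∘ z_X)`. -/
noncomputable def NhcTilde
    {z : SCat.Nhc.{u} ⋙ SSet.opFunctor.{u} ≅ SCat.opFunctor.{u} ⋙ SCat.Nhc.{u}}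
    {w : SCat.realization.{u} ⋙ SCat.opFunctor.{u} ≅ SSet.opFunctor.{u} ⋙ SCat.realization.{u}}
    (h : Coherent z w) : ISCat.{u} ⥤ ISSet.{u} :=
  liftFunctor SCat.Nhc z h.z_inv

/-! ### Mates of natural isomorphisms commuting with involutions -/

section Mate

variable {C : Type*} [Category C] {D : Type*} [Category D]
  {o : C ⥤ C} {e : o ⋙ o ≅ 𝟭 C} {oD : D ⥤ D} {eD : oD ⋙ oD ≅ 𝟭 D}
  {F : C ⥤ D} {R : D ⥤ C} (adj : F ⊣ R) (z : R ⋙ o ≅ oD ⋙ R)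

/-- The mate `F (Aᵒᵖ) ⟶ (F A)ᵒᵖ` of a natural isomorphism `z : (R -)ᵒᵖ ≅ R (-ᵒᵖ)`, for `F` left
adjoint to `R`. -/
def opMate (A : C) : F.obj (o.obj A) ⟶ oD.obj (F.obj A) :=
  F.map (o.map (adj.unit.app A)) ≫ F.map (z.hom.app (F.obj A)) ≫
    adj.counit.app (oD.obj (F.obj A))

theorem homEquiv_opMate (A : C) :
    adj.homEquiv _ _ (opMate adj z A) = o.map (adj.unit.app A) ≫ z.hom.app (F.obj A) := by
  rw [← Equiv.eq_symm_apply, adj.homEquiv_counit, F.map_comp, Category.assoc]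
  rfl

/-- Naturality of `z` at `f` moves `z` past `R(f)ᵒᵖ`; what remains, the unit followed by `R(f)`, is
the adjunct of `f`. All later facts about the mate are tested on adjuncts through this formula. -/
theorem homEquiv_opMate_comp (A : C) {X : D} (f : F.obj A ⟶ X) :
    adj.homEquiv _ _ (opMate adj z A ≫ oD.map f) =
      o.map (adj.homEquiv _ _ f) ≫ z.hom.app X := by
  have h := z.hom.naturality f
  dsimp at h
  rw [adj.homEquiv_naturality_right, homEquiv_opMate, adj.homEquiv_unit, Category.assoc, ← h,
    o.map_comp, Category.assoc]

theorem opMate_naturality {A B : C} (f : A ⟶ B) :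
    F.map (o.map f) ≫ opMate adj z B = opMate adj z A ≫ oD.map (F.map f) := by
  apply (adj.homEquiv _ _).injective
  rw [adj.homEquiv_naturality_left, homEquiv_opMate, homEquiv_opMate_comp, adj.homEquiv_unit,
    ← Category.assoc, ← o.map_comp]
  exact congrArg (fun t => o.map t ≫ z.hom.app (F.obj B)) (adj.unit_naturality f).symm

variable {z}

/-- If `z⁻¹ = zᵒᵖ`, then the mate of `z` at `Aᵒᵖ` is right inverse to the opposite of the mate
at `A`. -/
theorem opMate_op_comp_op_opMate (hz : InverseEqOp eD e z) (A : C) :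
    (F.map (e.inv.app A) ≫ opMate adj z (o.obj A)) ≫
      (oD.map (opMate adj z A) ≫ eD.hom.app (F.obj A)) = 𝟙 (F.obj A) := by
  apply (adj.homEquiv _ _).injective
  have hn := e.inv.naturality (adj.unit.app A)
  have h := hz (F.obj A)
  -- The formula is applied to `f = v_A` itself, whose adjunct again contains `z`. This produces the
  -- product of `zᵒᵖ` and `z` that `hz` cancels.
  have hm := homEquiv_opMate_comp adj z (o.obj A) (opMate adj z A)
  rw [homEquiv_opMate, o.map_comp] at hm
  dsimp at hn
  simp only [Category.assoc] at h hm ⊢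
  calc
    _ = e.inv.app A ≫ adj.homEquiv _ _ (opMate adj z (o.obj A) ≫ oD.map (opMate adj z A)) ≫
        R.map (eD.hom.app (F.obj A)) := by
      rw [adj.homEquiv_naturality_left, ← Category.assoc (opMate adj z (o.obj A)),
        adj.homEquiv_naturality_right]
    _ = adj.unit.app A ≫ e.inv.app (R.obj (F.obj A)) ≫ o.map (z.hom.app (F.obj A)) ≫
        z.hom.app (oD.obj (F.obj A)) ≫ R.map (eD.hom.app (F.obj A)) := by
      rw [reassoc_of% hn]
      refine (congrArg (fun t => e.inv.app A ≫ t ≫ R.map (eD.hom.app (F.obj A))) hm).trans ?_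
      simp only [Category.assoc]
    _ = adj.unit.app A := by rw [h]; exact Category.comp_id _
    _ = _ := (adj.homEquiv_id A).symm

/-- If `z⁻¹ = zᵒᵖ`, then the mate of `z` is an isomorphism. -/
def opMateIso (he : ∀ A, o.map (e.inv.app A) = e.inv.app (o.obj A))
    (heD : ∀ X, oD.map (eD.hom.app X) = eD.hom.app (oD.obj X)) (hz : InverseEqOp eD e z) (A : C) :
    F.obj (o.obj A) ≅ oD.obj (F.obj A) where
  hom := opMate adj z A
  inv := oD.map (F.map (e.inv.app A) ≫ opMate adj z (o.obj A)) ≫ eD.hom.app (F.obj (o.obj A))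
  hom_inv_id := by
    -- One law gives both inverse identities: here it is used at `Aᵒᵖ`, below its opposite is used
    -- at `A`. The conditions `he` and `heD` reconcile the two ways of identifying a triple opposite
    -- with a single one.
    have h := opMate_op_comp_op_opMate (e := e) adj hz (o.obj A)
    have hn := opMate_naturality adj z (e.inv.app A)
    rw [← he] at h
    dsimp at h hn ⊢
    rw [hn] at h
    simpa using h
  inv_hom_id := by
    have h := congrArg oD.map (opMate_op_comp_op_opMate (e := e) adj hz A)
    have hn := eD.hom.naturality (opMate adj z A)
    dsimp at hn
    rw [oD.map_comp, oD.map_comp _ (eD.hom.app _), heD] at h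
    rw [Category.assoc, ← hn]
    exact h.trans (oD.map_id _)

/-- If `z⁻¹ = zᵒᵖ`, the natural isomorphism `(F -)ᵒᵖ ≅ F (-ᵒᵖ)` inverse to the mate of `z`. -/
def opMateNatIso (he : ∀ A, o.map (e.inv.app A) = e.inv.app (o.obj A))
    (heD : ∀ X, oD.map (eD.hom.app X) = eD.hom.app (oD.obj X)) (hz : InverseEqOp eD e z) :
    F ⋙ oD ≅ o ⋙ F :=
  (NatIso.ofComponents (F := o ⋙ F) (G := F ⋙ oD) (opMateIso adj he heD hz)
    (fun f => opMate_naturality adj z f)).symm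

/-- The law for the mate is an equation between composites of isomorphisms. Inverting both sides
reverses the order of the factors and gives the law for the inverse of the mate. -/
theorem inverseEqOp_opMateNatIso (he : ∀ A, o.map (e.inv.app A) = e.inv.app (o.obj A))
    (heD : ∀ X, oD.map (eD.hom.app X) = eD.hom.app (oD.obj X)) (hz : InverseEqOp eD e z) :
    InverseEqOp e eD (opMateNatIso adj he heD hz) := by
  intro A
  let v := opMateIso adj he heD hz
  have h : (F.mapIso (e.symm.app A) ≪≫ v (o.obj A)) ≪≫ (oD.mapIso (v A) ≪≫ eD.app (F.obj A)) =
      Iso.refl _ := Iso.ext (opMate_op_comp_op_opMate adj hz A)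
  have hinv := congrArg Iso.inv h
  simp only [Iso.trans_inv, Functor.mapIso_inv, Iso.app_inv, Iso.symm_inv, Category.assoc] at hinv ⊢
  exact hinv

/-! ### Lifting the adjunction to objects with anti-involution -/

/-- A map `F A ⟶ X` is compatible with anti-involutions if and only if its adjunct is. -/
theorem comm_transport_iff (w : F ⋙ oD ≅ o ⋙ F) (hw : ∀ A, w.inv.app A = opMate adj z A)
    {A : C} (σ : o.obj A ⟶ A) {X : D} (τ : oD.obj X ⟶ X) (f : F.obj A ⟶ X) :
    oD.map f ≫ τ = transport w σ ≫ f ↔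
      o.map (adj.homEquiv _ _ f) ≫ transport z τ = σ ≫ adj.homEquiv _ _ f := by
  -- Cancelling `w_A` puts its inverse, the mate, in front of `fᵒᵖ`; both sides then start at `F
  -- (Aᵒᵖ)` and can be transposed.
  have h : oD.map f ≫ τ = transport w σ ≫ f ↔
      (opMate adj z A ≫ oD.map f) ≫ τ = F.map σ ≫ f := by
    rw [← hw, Category.assoc, transport, Category.assoc]
    exact (Iso.inv_comp_eq (w.app A)).symm
  rw [h, ← (adj.homEquiv _ _).apply_eq_iff_eq, adj.homEquiv_naturality_right,
    homEquiv_opMate_comp, adj.homEquiv_naturality_left, Category.assoc, transport]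

/-- The adjunction between the functors on objects with anti-involution which lifts a given
adjunction. -/
def liftAdjunction (w : F ⋙ oD ≅ o ⋙ F) (hz : InverseEqOp eD e z) (hw : InverseEqOp e eD w)
    (h : ∀ A, w.inv.app A = opMate adj z A) : liftFunctor F w hw ⊣ liftFunctor R z hz :=
  Adjunction.mkOfHomEquiv
    { homEquiv A X :=
        { toFun f := ⟨adj.homEquiv _ _ f.hom, (comm_transport_iff adj w h A.τ X.τ f.hom).1 f.comm⟩
          invFun g := ⟨(adj.homEquiv _ _).symm g.hom, (comm_transport_iff adj w h A.τ X.τ _).2 (by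
            have h := (adj.homEquiv A.obj X.obj).apply_symm_apply g.hom
            exact h.symm ▸ g.comm)⟩
          left_inv f := AntiInvolutive.Hom.ext ((adj.homEquiv _ _).symm_apply_apply f.hom)
          right_inv g := AntiInvolutive.Hom.ext ((adj.homEquiv _ _).apply_symm_apply g.hom) }
      homEquiv_naturality_left_symm f g :=
        AntiInvolutive.Hom.ext (adj.homEquiv_naturality_left_symm f.hom g.hom)
      homEquiv_naturality_right f g :=
        AntiInvolutive.Hom.ext (adj.homEquiv_naturality_right f.hom g.hom) }

theorem liftAdjunction_homEquiv_hom (w : F ⋙ oD ≅ o ⋙ F) (hz : InverseEqOp eD e z)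
    (hw : InverseEqOp e eD w) (h : ∀ A, w.inv.app A = opMate adj z A) {A : AntiInvolutive o e}
    {X : AntiInvolutive oD eD} (f : (liftFunctor F w hw).obj A ⟶ X) :
    ((liftAdjunction adj w hz hw h).homEquiv A X f).hom = adj.homEquiv A.obj X.obj f.hom := by
  simp only [liftAdjunction, Adjunction.mkOfHomEquiv_homEquiv]
  rfl

end Mate

/-! ### Order reversal on simplicial thickenings -/

namespace SCat

section Reversal

variable {J K M : Type u} [LinearOrder J] [LinearOrder K] [LinearOrder M]

/-- Paths are ordered by inclusion, so a simplex of a hom is a functor into a thin category.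
Equalities of simplicial functors thereby reduce to equalities of subsets of the linear order. -/
instance (i j : SimplicialThickening J) : Quiver.IsThin (i ⟶ j) := fun _ _ =>
  ⟨fun f g => by
    obtain ⟨f⟩ := f
    obtain ⟨g⟩ := g
    exact congrArg _ (Subsingleton.elim f g)⟩

/-- Simplices of the hom objects of a thickening are determined by their vertices. -/
theorem thickening_simp_ext {i j : SimplicialThickening J} {m : SimplexCategoryᵒᵖ}
    {s t : Simp m i j}
    (h : ∀ k, (Functor.obj (D := i ⟶ j) s k).I = (Functor.obj (D := i ⟶ j) t k).I) : s = t :=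
  CategoryTheory.Functor.ext (D := i ⟶ j) (fun k => SimplicialThickening.Path.ext (h k))
    (fun _ _ _ => Subsingleton.elim _ _)

/-- The functor on paths induced by an antitone map. -/
def revPath (f : J →o Kᵒᵈ) (i j : SimplicialThickening J) :
    (i ⟶ j) ⥤ (SimplicialThickening.mk (OrderDual.ofDual (f j.as)) ⟶
      SimplicialThickening.mk (OrderDual.ofDual (f i.as))) where
  obj p := ⟨(fun k => OrderDual.ofDual (f k)) '' p.I, ⟨_, p.right, rfl⟩, ⟨_, p.left, rfl⟩,
    by rintro _ ⟨k, hk, rfl⟩; exact f.monotone (p.le_right k hk),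
    by rintro _ ⟨k, hk, rfl⟩; exact f.monotone (p.left_le k hk)⟩
  map g := ⟨⟨⟨Set.image_mono g.1.1.1⟩⟩⟩

/-- The simplicial functor from the thickening of `J` to the opposite of the thickening of `K`
induced by an antitone map `J → K`. -/
def revFunctor (f : J →o Kᵒᵈ) :
    EnrichedFunctor SSet.{u} (SimplicialThickening J) (SimplicialThickening K)ᵒᵖ where
  obj x := op (.mk (OrderDual.ofDual (f x.as)))
  map i j := nerveMap (revPath f i j)
  map_id i := by
    ext m s
    exact thickening_simp_ext fun k => Set.image_singleton
  map_comp i j k := by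
    ext m ⟨s, t⟩
    -- Paths compose by union, so the swapped order of composition in the opposite category is
    -- harmless.
    exact thickening_simp_ext fun k => (Set.image_union ..).trans (Set.union_comm ..)

theorem functor_comp_revFunctor (f : J →o K) (g : K →o Mᵒᵈ) :
    (SimplicialThickening.functor f).comp SSet.{u} (revFunctor g) = revFunctor (g.comp f) :=
  functor_ext (fun _ => rfl) fun i j _ _ => heq_of_eq
    (thickening_simp_ext (J := M) (i := .mk (g (f j.as))) (j := .mk (g (f i.as)))
      fun _ => Set.image_image ..)

theorem revFunctor_comp_opMap_functor (f : J →o Kᵒᵈ) (g : K →o M) :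
    (revFunctor f).comp SSet.{u} (opMap (X := ⟨SimplicialThickening K⟩)
      (Y := ⟨SimplicialThickening M⟩) (SimplicialThickening.functor g)) =
      revFunctor (g.dual.comp f) :=
  functor_ext (fun _ => rfl) fun i j _ _ => heq_of_eq
    (thickening_simp_ext (J := M) (i := .mk (g (f j.as))) (j := .mk (g (f i.as)))
      fun _ => Set.image_image ..)

theorem revFunctor_comp_opMap_revFunctor (f : J →o Kᵒᵈ) (g : K →o Mᵒᵈ) :
    ((revFunctor f).comp SSet.{u} (opMap (X := ⟨SimplicialThickening K⟩)
      (Y := ⟨(SimplicialThickening M)ᵒᵖ⟩) (revFunctor g))).comp SSet.{u}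
        (opOpIsoApp ⟨SimplicialThickening M⟩).hom =
      SimplicialThickening.functor (g.dual.comp f) :=
  functor_ext (fun _ => rfl) fun i j _ _ => heq_of_eq
    (thickening_simp_ext (J := M) (i := .mk (g (f i.as))) (j := .mk (g (f j.as)))
      fun _ => Set.image_image ..)

end Reversal

/-! ### Reversal and the nerve of the opposite category -/

/-- The order-reversing bijection of `{0 < ... < n}`. -/
def finRev (n : ℕ) : ULift.{u} (Fin n) →o (ULift.{u} (Fin n))ᵒᵈ where
  toFun i := OrderDual.toDual ⟨i.down.rev⟩
  monotone' _ _ h := Fin.rev_le_rev.2 h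

/-- The isomorphism from the thickening of `{0 < ... < n}` to its opposite. -/
def thickeningRev (n : SimplexCategory) :
    thickening.{u}.obj n ⟶ opFunctor.obj (thickening.{u}.obj n) :=
  revFunctor (finRev (n.len + 1))

theorem thickeningRev_naturality {n n' : SimplexCategory} (f : n ⟶ n') :
    thickening.{u}.map f ≫ thickeningRev n' =
      thickeningRev n ≫ opFunctor.map (thickening.map (SimplexCategory.rev.map f)) := by
  refine (functor_comp_revFunctor _ _).trans
    (Eq.trans ?_ (revFunctor_comp_opMap_functor _ _).symm)
  congr 1
  ext i
  -- `SimplexCategory.rev` conjugates `f` by the reversal, so two of the three reversals on the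
  -- right cancel.
  change (f.toOrderHom i.down).rev.val = (f.toOrderHom i.down.rev.rev).rev.val
  rw [Fin.rev_rev]

theorem thickeningRev_comp_op (n : SimplexCategory) :
    thickeningRev.{u} n ≫ opFunctor.map (thickeningRev n) ≫ opOpIso.hom.app (thickening.obj n) =
      𝟙 (thickening.obj n) := by
  refine (revFunctor_comp_opMap_revFunctor _ _).trans
    (Eq.trans ?_ (SimplicialThickening.functor_id _))
  congr 1
  ext i
  exact congrArg Fin.val (Fin.rev_rev i.down)

/-- Naturality of the double-opposite identification moves `s` outside, leaving the square of the
reversal. Applied to simplices, this one identity proves both that `nhcOp` is invertible and that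
`z⁻¹ = zᵒᵖ`. -/
theorem thickeningRev_comp_op_comp {n : SimplexCategory} {X : SCat.{u}}
    (s : thickening.obj n ⟶ X) :
    thickeningRev n ≫ opFunctor.map (thickeningRev n ≫ opFunctor.map s) ≫ opOpIso.hom.app X =
      s := by
  have hn := opOpIso.hom.naturality s
  have h := thickeningRev_comp_op.{u} n
  dsimp only [Functor.comp_map, Functor.id_map] at hn
  rw [Functor.map_comp, Category.assoc, hn, reassoc_of% h]

/-- The map `(N_hc X)ᵒᵖ ⟶ N_hc (Xᵒᵖ)` precomposing opposites of simplices with the reversal. -/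
def nhcOp (X : SCat.{u}) : SSet.opFunctor.obj (Nhc.obj X) ⟶ Nhc.obj (opFunctor.obj X) where
  app m := ↾fun s => ULift.up (thickeningRev m.unop ≫ opFunctor.map (ULift.down s))
  naturality m m' f := by
    ext s
    have h := thickeningRev_naturality.{u} f.unop
    refine congrArg ULift.up ?_
    -- An operator acts on the opposite simplicial set through its conjugate by the reversal.
    change thickeningRev m'.unop ≫ opFunctor.map
      (thickening.map (SimplexCategory.rev.map f.unop) ≫ ULift.down s) =
        thickening.map f.unop ≫ thickeningRev m.unop ≫ opFunctor.map (ULift.down s)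
    rw [opFunctor.map_comp, reassoc_of% h]

theorem nhcOp_naturality {X Y : SCat.{u}} (F : X ⟶ Y) :
    SSet.opFunctor.map (Nhc.map F) ≫ nhcOp Y = nhcOp X ≫ Nhc.map (opFunctor.map F) := by
  ext m s
  rfl

theorem op_nhcOp_comp_nhcOp (X : SCat.{u}) :
    (SSet.opFunctorCompOpFunctorIso.inv.app (Nhc.obj X) ≫ SSet.opFunctor.map (nhcOp X)) ≫
      (nhcOp (opFunctor.obj X) ≫ Nhc.map (opOpIso.hom.app X)) = 𝟙 (Nhc.obj X) := by
  ext m s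
  exact congrArg ULift.up (thickeningRev_comp_op_comp (ULift.down s))

/-- The isomorphism `(N_hc X)ᵒᵖ ≅ N_hc (Xᵒᵖ)`. -/
def nhcOpIso (X : SCat.{u}) :
    SSet.opFunctor.obj (Nhc.obj X) ≅ Nhc.obj (opFunctor.obj X) where
  hom := nhcOp X
  -- The required law `z⁻¹ = zᵒᵖ` dictates this inverse: the opposite of the map at `Xᵒᵖ`.
  inv := SSet.opFunctorCompOpFunctorIso.inv.app (Nhc.obj (opFunctor.obj X)) ≫
    SSet.opFunctor.map (nhcOp (opFunctor.obj X) ≫ Nhc.map (opOpIso.hom.app X))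
  hom_inv_id := by
    ext m s
    exact congrArg ULift.up (thickeningRev_comp_op_comp (ULift.down s))
  inv_hom_id := by
    ext m s
    exact congrArg ULift.up (thickeningRev_comp_op_comp (ULift.down s))

/-- The natural isomorphism `(N_hc -)ᵒᵖ ≅ N_hc (-ᵒᵖ)`. -/
def nhcOpNatIso : Nhc.{u} ⋙ SSet.opFunctor.{u} ≅ opFunctor.{u} ⋙ Nhc.{u} :=
  NatIso.ofComponents nhcOpIso nhcOp_naturality

theorem inverseEqOp_nhcOpNatIso :
    InverseEqOp opOpIso SSet.opFunctorCompOpFunctorIso nhcOpNatIso.{u} :=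
  op_nhcOp_comp_nhcOp

end SCat

theorem mainTheorem9 :
    (∃ (z : SCat.Nhc.{u} ⋙ SSet.opFunctor.{u} ≅ SCat.opFunctor.{u} ⋙ SCat.Nhc.{u})
       (w : SCat.realization.{u} ⋙ SCat.opFunctor.{u} ≅
          SSet.opFunctor.{u} ⋙ SCat.realization.{u}), Coherent z w) ∧
    ∀ (z : SCat.Nhc.{u} ⋙ SSet.opFunctor.{u} ≅ SCat.opFunctor.{u} ⋙ SCat.Nhc.{u})
      (w : SCat.realization.{u} ⋙ SCat.opFunctor.{u} ≅ SSet.opFunctor.{u} ⋙ SCat.realization.{u})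
      (h : Coherent z w),
      (∀ (X : SCat.{u}) (τ : SCat.opFunctor.obj X ⟶ X),
        IsAntiInvolution SCat.opFunctor SCat.opOpIso τ →
          IsAntiInvolution SSet.opFunctor SSet.opFunctorCompOpFunctorIso (transport z τ)) ∧
      (∀ (A : SSet.{u}) (σ : SSet.opFunctor.obj A ⟶ A),
        IsAntiInvolution SSet.opFunctor SSet.opFunctorCompOpFunctorIso σ →
          IsAntiInvolution SCat.opFunctor SCat.opOpIso (transport w σ)) ∧
      ∃ adj' : realizationTilde h ⊣ NhcTilde h,
        ∀ (A : ISSet.{u}) (X : ISCat.{u}) (f : (realizationTilde h).obj A ⟶ X),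
          (adj'.homEquiv A X f).hom = SCat.adj.homEquiv A.obj X.obj f.hom := by
  -- Both double-opposite identifications satisfy the triple-opposite condition definitionally. The
  -- last coherence condition is also definitional, since `w` is built as the inverse of the mate.
  refine ⟨⟨SCat.nhcOpNatIso, opMateNatIso SCat.adj (fun _ => rfl) (fun _ => rfl)
    SCat.inverseEqOp_nhcOpNatIso, SCat.inverseEqOp_nhcOpNatIso,
    inverseEqOp_opMateNatIso SCat.adj _ _ _, fun _ => rfl⟩, fun z w h =>
    ⟨fun _ _ hτ => hτ.transport h.z_inv, fun _ _ hσ => hσ.transport h.w_inv,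
      -- For an arbitrary coherent pair, `h.w_eq` says precisely that `w⁻¹` is the mate of `z`.
      liftAdjunction SCat.adj w h.z_inv h.w_inv h.w_eq, fun _ _ f =>
      liftAdjunction_homEquiv_hom SCat.adj w h.z_inv h.w_inv h.w_eq f⟩⟩
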